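/- **Theorem.** Let $A,B$ be positive semidefinite complex $n\times n$ matrices, let $X$ be any complex $n\times n$ matrix, and let $s,t$ be real numbers with $0\le s<\frac12$ and $|1-2t|<\frac{1-2s}{2}$. Then for every unitarily invariant norm $|||\cdot|||$ on the complex $n\times n$ matrices (that is, a norm with $|||UYV|||=|||Y|||$ for all matrices $Y$ and all unitary matrices $U,V$), $$|||A^{1-t}XB^{t}+A^{t}XB^{1-t}|||\le \frac{2}{1-2s}\,\Bigl|\Bigl|\Bigl|\int_s^{1-s}A^{v}XB^{1-v}\,dv\Bigr|\Bigr|\Bigr|.$$ Here the real powers are defined by the functional calculus and the matrix integral is taken entrywise. -/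

import Mathlib

open scoped MatrixOrder ComplexOrder

/-- A norm on the complex matrices with index set `n` (a definite seminorm) is unitarily invariant
if multiplying by unitary matrices on the left and on the right does not change it. -/
structure IsUnitarilyInvariantNorm {n : Type*} [Fintype n] [DecidableEq n]
    (N : Seminorm ℂ (Matrix n n ℂ)) : Prop where
  definite : ∀ X : Matrix n n ℂ, N X = 0 → X = 0
  unitary_mul_mul : ∀ U ∈ Matrix.unitaryGroup n ℂ, ∀ V ∈ Matrix.unitaryGroup n ℂ,
    ∀ X : Matrix n n ℂ, N (U * X * V) = N X

/-- The integral over the interval from `a` to `b` of a matrix-valued function, taken entrywise. -/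
noncomputable def matrixIntegral {n : Type*} (F : ℝ → Matrix n n ℂ) (a b : ℝ) : Matrix n n ℂ :=
  Matrix.of fun i j => ∫ v in a..b, F v i j

/-!
Diagonalize `A = U diag(a) U*` and `B = V diag(b) V*`. Unitary invariance turns the inequality into
one between two entrywise multiples of `U* X V`, and the first matrix is `2 / (1 - 2s)` times the
Hadamard product of the second one with the matrix `φ (log aᵢ - log bⱼ)`, where
`φ r = c r cosh (β r) / sinh (c r)` with `c = (1 - 2s) / 2` and `β = (1 - 2t) / 2`
(`heinz_eq_coshDivSinhc_mul_integral`). It remains to see that Hadamard multiplication by this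
matrix does not increase the norm.

This holds because `φ`, with `φ 0 = 1`, is positive definite when `2 |β| ≤ c`. Integral
representations are avoided: the Hadamard multipliers that do not increase the norm are closed under
products, convex combinations and pointwise limits, and contain the characters `exp (i τ (xᵢ - yⱼ))`,
which act by diagonal unitaries. Geometric mixtures of characters then tend to the resolvents
`1 / (1 + i a r)`, products of conjugate resolvents are `1 / (1 + a² r²)`, and convex combinations
with `1` are the quotients `(1 + b² r²) / (1 + a² r²)` with `b² ≤ a²`. By the Euler products of
`cosh` and `sinh`, `φ` is an infinite product of such quotients
(`IsUnitarilyInvariantNorm.isContractiveMultiplier_coshDivSinhc`).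
-/

open Filter Topology
open scoped Matrix

/-! ### Contractive Schur multipliers -/

/-- Entrywise multiplication by `m` does not increase the seminorm `N`. -/
def IsContractiveMultiplier {n : Type*} (N : Seminorm ℂ (Matrix n n ℂ)) (m : Matrix n n ℂ) : Prop :=
  ∀ Y : Matrix n n ℂ, N (m ⊙ Y) ≤ N Y

theorem Seminorm.continuous_matrix {n : Type*} [Fintype n] (N : Seminorm ℂ (Matrix n n ℂ)) :
    Continuous N := by
  classical
  refine Seminorm.continuous_of_continuousAt_zero ?_
  have hsum : ∀ f : n → Matrix n n ℂ, N (∑ i, f i) ≤ ∑ i, N (f i) := fun f =>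
    Finset.le_sum_of_subadditive N (map_zero N).le (map_add_le_add N) _ _
  have hle : ∀ Y : Matrix n n ℂ, N Y ≤ ∑ i, ∑ j, ‖Y i j‖ * N (Matrix.single i j 1) := by
    intro Y
    conv_lhs => rw [Matrix.matrix_eq_sum_single Y]
    refine (hsum _).trans (Finset.sum_le_sum fun i _ => ?_)
    refine (hsum _).trans (Finset.sum_le_sum fun j _ => ?_)
    rw [← map_smul_eq_mul, Matrix.smul_single, smul_eq_mul, mul_one]
  have hcont : Continuous fun Y : Matrix n n ℂ =>
      ∑ i, ∑ j, ‖Y i j‖ * N (Matrix.single i j 1) := by fun_prop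
  have h0 := hcont.tendsto 0
  simp only [Matrix.zero_apply, norm_zero, zero_mul, Finset.sum_const_zero] at h0
  rw [ContinuousAt, map_zero]
  exact squeeze_zero (fun Y => apply_nonneg N Y) hle h0

namespace IsContractiveMultiplier

variable {n : Type*} {N : Seminorm ℂ (Matrix n n ℂ)}

theorem one : IsContractiveMultiplier N (Matrix.of fun _ _ => 1) := fun Y => by
  exact le_of_eq (congrArg N (Matrix.of_one_hadamard Y))

theorem hadamard {m m' : Matrix n n ℂ} (h : IsContractiveMultiplier N m)
    (h' : IsContractiveMultiplier N m') : IsContractiveMultiplier N (m ⊙ m') := fun Y => by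
  rw [Matrix.hadamard_assoc]
  exact (h _).trans (h' Y)

theorem convex_combination {m m' : Matrix n n ℂ} (h : IsContractiveMultiplier N m)
    (h' : IsContractiveMultiplier N m') {a b : ℝ} (ha : 0 ≤ a) (hb : 0 ≤ b) (hab : a + b = 1) :
    IsContractiveMultiplier N ((a : ℂ) • m + (b : ℂ) • m') := fun Y => by
  rw [Matrix.add_hadamard, Matrix.smul_hadamard, Matrix.smul_hadamard]
  refine (map_add_le_add N _ _).trans ?_
  rw [map_smul_eq_mul, map_smul_eq_mul, Complex.norm_of_nonneg ha, Complex.norm_of_nonneg hb]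
  calc a * N (m ⊙ Y) + b * N (m' ⊙ Y) ≤ a * N Y + b * N Y := by
        gcongr
        exacts [h Y, h' Y]
    _ = N Y := by rw [← add_mul, hab, one_mul]

theorem of_tendsto [Fintype n] {ι : Type*} {l : Filter ι} [l.NeBot] {f : ι → n → n → ℂ}
    {m : n → n → ℂ} (hf : ∀ᶠ k in l, IsContractiveMultiplier N (Matrix.of (f k)))
    (hm : ∀ i j, Tendsto (fun k => f k i j) l (𝓝 (m i j))) :
    IsContractiveMultiplier N (Matrix.of m) := fun Y => by
  have hlim : Tendsto (fun k => Matrix.of (f k) ⊙ Y) l (𝓝 (Matrix.of m ⊙ Y)) :=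
    tendsto_pi_nhds.2 fun i => tendsto_pi_nhds.2 fun j => (hm i j).mul_const (Y i j)
  exact le_of_tendsto (((Seminorm.continuous_matrix N).tendsto _).comp hlim)
    (hf.mono fun k hk => hk Y)

/-- The expectation `∑ₖ p (1 - p) ^ k ψ ^ k` of the powers of a contractive multiplier under a
geometric law is contractive. -/
theorem geometric {f : n → n → ℂ} (h : IsContractiveMultiplier N (Matrix.of f)) {p : ℝ}
    (hp : 0 < p) (hp1 : p ≤ 1) (hf : ∀ i j, 1 - (1 - p) * f i j ≠ 0) :
    IsContractiveMultiplier N (Matrix.of fun i j => p / (1 - (1 - p) * f i j)) := fun Y => by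
  set Z := (Matrix.of fun i j => (p : ℂ) / (1 - (1 - p) * f i j)) ⊙ Y with hZ
  have hfix : Z = (p : ℂ) • Y + ((1 - p : ℝ) : ℂ) • (Matrix.of f ⊙ Z) := by
    ext i j
    have := hf i j
    simp only [hZ, Matrix.hadamard_apply, Matrix.of_apply, Matrix.add_apply, Matrix.smul_apply,
      smul_eq_mul]
    push_cast
    field_simp
    ring
  have hle : N Z ≤ p * N Y + (1 - p) * N Z := by
    calc N Z = N ((p : ℂ) • Y + ((1 - p : ℝ) : ℂ) • (Matrix.of f ⊙ Z)) := congrArg N hfix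
      _ ≤ p * N Y + (1 - p) * N (Matrix.of f ⊙ Z) := by
        refine (map_add_le_add N _ _).trans_eq ?_
        rw [map_smul_eq_mul, map_smul_eq_mul, Complex.norm_of_nonneg hp.le,
          Complex.norm_of_nonneg (sub_nonneg.2 hp1)]
      _ ≤ _ := by
        have := h Z
        have := sub_nonneg.2 hp1
        gcongr
  nlinarith

end IsContractiveMultiplier

/-! ### Multipliers that are functions of the difference of two sequences -/

section Difference

variable {n : Type*} [Fintype n] [DecidableEq n] {N : Seminorm ℂ (Matrix n n ℂ)}

theorem IsUnitarilyInvariantNorm.isContractiveMultiplier_character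
    (hN : IsUnitarilyInvariantNorm N) (x y : n → ℝ) (c : ℝ) :
    IsContractiveMultiplier N
      (Matrix.of fun i j => Complex.exp (c * (x i - y j) * Complex.I)) := fun Y => by
  have hU : ∀ z : n → ℝ, Matrix.diagonal (fun i => Complex.exp (z i * Complex.I)) ∈
      Matrix.unitaryGroup n ℂ := by
    intro z
    rw [Matrix.mem_unitaryGroup_iff, Matrix.star_eq_conjTranspose, Matrix.diagonal_conjTranspose,
      Matrix.diagonal_mul_diagonal, ← Matrix.diagonal_one]
    congr 1
    ext i
    rw [Pi.star_apply, RCLike.star_def, Complex.mul_conj, Complex.normSq_eq_norm_sq,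
      Complex.norm_exp_ofReal_mul_I]
    simp
  refine le_of_eq ?_
  rw [← hN.unitary_mul_mul _ (hU fun i => c * x i) _ (hU fun j => -(c * y j)) Y]
  congr 1
  ext i j
  rw [Matrix.mul_diagonal, Matrix.diagonal_mul, Matrix.hadamard_apply, Matrix.of_apply,
    mul_right_comm (Complex.exp _), ← Complex.exp_add]
  congr 2
  push_cast
  ring

/-- `1 / (1 + i r)` is the characteristic function of an exponential law, hence a limit of
characteristic functions of rescaled geometric laws. -/
theorem IsUnitarilyInvariantNorm.isContractiveMultiplier_resolvent
    (hN : IsUnitarilyInvariantNorm N) (x y : n → ℝ) (c : ℝ) :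
    IsContractiveMultiplier N
      (Matrix.of fun i j => (1 + c * (x i - y j) * Complex.I)⁻¹) := by
  -- The geometric law with parameter `p = h / (1 + h)` on the multiples of `h`.
  have hgeo : ∀ᶠ h : ℝ in 𝓝[>] 0, IsContractiveMultiplier N (Matrix.of fun i j =>
      (1 + (h : ℂ)⁻¹ * (1 - Complex.exp ((-(h * c) : ℝ) * (x i - y j) * Complex.I)))⁻¹) := by
    filter_upwards [self_mem_nhdsWithin] with h hh
    replace hh : 0 < h := hh
    have hc : (h : ℂ) ≠ 0 := by exact_mod_cast hh.ne'
    have hc1 : (1 + h : ℂ) ≠ 0 := by exact_mod_cast (by positivity : (1 + h : ℝ) ≠ 0)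
    have hne : ∀ i j,
        (1 + h : ℂ) - Complex.exp ((-(h * c) : ℝ) * (x i - y j) * Complex.I) ≠ 0 := by
      intro i j h0
      have h1 := congrArg norm (sub_eq_zero.1 h0)
      rw [← Complex.ofReal_sub, ← Complex.ofReal_mul, Complex.norm_exp_ofReal_mul_I,
        ← Complex.ofReal_one, ← Complex.ofReal_add, Complex.norm_of_nonneg (by positivity)] at h1
      linarith
    have key := (hN.isContractiveMultiplier_character x y (-(h * c))).geometric
      (p := h / (1 + h)) (by positivity) (by rw [div_le_one (by positivity)]; linarith) ?_
    · convert key using 5 with i j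
      have := hne i j
      generalize Complex.exp _ = e at *
      push_cast
      have h2 : (1 + (h : ℂ)⁻¹ * (1 - e)) = (1 + h - e) / h := by field_simp; ring
      have h3 : (1 - (1 - h / (1 + h)) * e) = (1 + h - e) / (1 + h) := by field_simp; ring
      rw [h2, h3]
      field_simp
    · intro i j
      have := hne i j
      generalize Complex.exp _ = e at *
      push_cast
      have h3 : (1 - (1 - h / (1 + h)) * e) = (1 + h - e) / (1 + h) := by field_simp; ring
      rw [h3]
      exact div_ne_zero this hc1
  refine IsContractiveMultiplier.of_tendsto hgeo fun i j => ?_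
  have hd : HasDerivAt (fun h : ℝ => 1 - Complex.exp ((-(h * c) : ℝ) * (x i - y j) * Complex.I))
      (c * (x i - y j) * Complex.I) 0 := by
    have h1 : HasDerivAt (fun h : ℝ => ((-(h * c) : ℝ) : ℂ) * (x i - y j) * Complex.I)
        (((-(1 * c) : ℝ) : ℂ) * (x i - y j) * Complex.I) 0 :=
      ((((hasDerivAt_id (0 : ℝ)).mul_const c).neg.ofReal_comp).mul_const _).mul_const _
    convert! h1.cexp.const_sub 1 using 1
    simp
  have hs := hd.tendsto_slope_zero_right
  simp only [zero_add, zero_mul, neg_zero, Complex.ofReal_zero, Complex.exp_zero, sub_self,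
    sub_zero, Complex.real_smul, Complex.ofReal_inv] at hs
  refine (tendsto_const_nhds.add hs).inv₀ fun h0 => ?_
  -- The limit of the denominators has real part `1`.
  have := congrArg Complex.re h0
  rw [← Complex.ofReal_sub, ← Complex.ofReal_mul] at this
  simp at this

/-- For `b ^ 2 ≤ a ^ 2`, the function `(1 + b² r²) / (1 + a² r²)` is a convex combination of the
constant `1` and of `1 / (1 + a² r²)`, the product of two conjugate resolvents. -/
theorem IsUnitarilyInvariantNorm.isContractiveMultiplier_quotient
    (hN : IsUnitarilyInvariantNorm N) (x y : n → ℝ) {a b : ℝ} (ha : a ≠ 0) (hab : b ^ 2 ≤ a ^ 2) :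
    IsContractiveMultiplier N (Matrix.of fun i j =>
      (((1 + b ^ 2 * (x i - y j) ^ 2) / (1 + a ^ 2 * (x i - y j) ^ 2) : ℝ) : ℂ)) := by
  have ha2 : 0 < a ^ 2 := by positivity
  have key := IsContractiveMultiplier.one.convex_combination
    ((hN.isContractiveMultiplier_resolvent x y a).hadamard
      (hN.isContractiveMultiplier_resolvent x y (-a)))
    (a := b ^ 2 / a ^ 2) (b := 1 - b ^ 2 / a ^ 2) (by positivity)
    (sub_nonneg.2 ((div_le_one ha2).2 hab)) (by ring)
  convert key using 1
  ext i j
  have hprod : (1 + a * (x i - y j) * Complex.I) * (1 + (-a : ℝ) * (x i - y j) * Complex.I) =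
      ((1 + a ^ 2 * (x i - y j) ^ 2 : ℝ) : ℂ) := by
    push_cast
    linear_combination -(a : ℂ) ^ 2 * (x i - y j) ^ 2 * Complex.I_sq
  simp only [Matrix.add_apply, Matrix.smul_apply, Matrix.hadamard_apply, Matrix.of_apply,
    smul_eq_mul, mul_one]
  rw [← mul_inv, hprod, ← Complex.ofReal_inv, ← Complex.ofReal_mul, ← Complex.ofReal_add]
  congr 1
  field_simp
  ring

theorem IsUnitarilyInvariantNorm.isContractiveMultiplier_prod_quotient
    (hN : IsUnitarilyInvariantNorm N) (x y : n → ℝ) {a b : ℕ → ℝ} (ha : ∀ k, a k ≠ 0)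
    (hab : ∀ k, b k ^ 2 ≤ a k ^ 2) (K : ℕ) :
    IsContractiveMultiplier N (Matrix.of fun i j =>
      ((∏ k ∈ Finset.range K,
        (1 + b k ^ 2 * (x i - y j) ^ 2) / (1 + a k ^ 2 * (x i - y j) ^ 2) : ℝ) : ℂ)) := by
  induction K with
  | zero => simpa using IsContractiveMultiplier.one
  | succ K ih =>
    convert ih.hadamard (hN.isContractiveMultiplier_quotient x y (ha K) (hab K)) using 1
    ext i j
    rw [Matrix.hadamard_apply, Matrix.of_apply, Matrix.of_apply, Matrix.of_apply,
      Finset.prod_range_succ, Complex.ofReal_mul]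

end Difference

/-! ### Euler products for the hyperbolic functions -/

theorem tendsto_euler_sinh_prod (w : ℝ) :
    Tendsto (fun K : ℕ => Real.pi * w * ∏ k ∈ Finset.range K, (1 + w ^ 2 / ((k : ℝ) + 1) ^ 2))
      atTop (𝓝 (Real.sinh (Real.pi * w))) := by
  have h := (Complex.continuous_im.tendsto _).comp (Complex.tendsto_euler_sin_prod (w * Complex.I))
  convert! h using 1
  · ext K
    have h1 : ∀ k : ℕ, (1 - (w * Complex.I) ^ 2 / ((k : ℂ) + 1) ^ 2) =
        ((1 + w ^ 2 / ((k : ℝ) + 1) ^ 2 : ℝ) : ℂ) := by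
      intro k
      rw [mul_pow, Complex.I_sq]
      push_cast
      ring
    simp only [Function.comp_apply, h1]
    rw [← Complex.ofReal_prod, ← mul_assoc, ← Complex.ofReal_mul, mul_right_comm _ Complex.I,
      ← Complex.ofReal_mul, Complex.im_ofReal_mul, Complex.I_im, mul_one]
  · rw [← mul_assoc, ← Complex.ofReal_mul, Complex.sin_mul_I, ← Complex.ofReal_sinh,
      Complex.im_ofReal_mul, Complex.I_im, mul_one]

theorem tendsto_euler_sinh_div_prod {w : ℝ} (hw : w ≠ 0) :
    Tendsto (fun K : ℕ => ∏ k ∈ Finset.range K, (1 + w ^ 2 / ((k : ℝ) + 1) ^ 2))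
      atTop (𝓝 (Real.sinh (Real.pi * w) / (Real.pi * w))) := by
  have hpw : Real.pi * w ≠ 0 := mul_ne_zero Real.pi_ne_zero hw
  refine ((tendsto_euler_sinh_prod w).div_const (Real.pi * w)).congr fun K => ?_
  field_simp

theorem tendsto_euler_cosh_prod (w : ℝ) :
    Tendsto (fun K : ℕ => ∏ k ∈ Finset.range K, (1 + w ^ 2 / ((k : ℝ) + 1 / 2) ^ 2))
      atTop (𝓝 (Real.cosh (Real.pi * w))) := by
  rcases eq_or_ne w 0 with rfl | hw
  · simp
  have hpw : Real.pi * w ≠ 0 := mul_ne_zero Real.pi_ne_zero hw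
  have hsinh : Real.sinh (Real.pi * w) ≠ 0 := by rwa [ne_eq, Real.sinh_eq_zero]
  -- The odd-indexed factors of the product for `sinh (2πw)` are the factors for `sinh (πw)`, and
  -- the even-indexed ones are those sought, since `cosh (πw) = sinh (2πw) / (2 sinh (πw))`.
  have hsplit : ∀ K : ℕ,
      ∏ k ∈ Finset.range (2 * K), (1 + (2 * w) ^ 2 / ((k : ℝ) + 1) ^ 2) =
        (∏ k ∈ Finset.range K, (1 + w ^ 2 / ((k : ℝ) + 1 / 2) ^ 2)) *
          ∏ k ∈ Finset.range K, (1 + w ^ 2 / ((k : ℝ) + 1) ^ 2) := by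
    intro K
    induction K with
    | zero => simp
    | succ K ih =>
      have h1 : (2 * w) ^ 2 / (((2 * K : ℕ) : ℝ) + 1) ^ 2 = w ^ 2 / ((K : ℝ) + 1 / 2) ^ 2 := by
        push_cast
        field_simp
      have h2 : (2 * w) ^ 2 / (((2 * K + 1 : ℕ) : ℝ) + 1) ^ 2 = w ^ 2 / ((K : ℝ) + 1) ^ 2 := by
        push_cast
        field_simp
        ring
      rw [mul_add, mul_one, Finset.prod_range_succ, Finset.prod_range_succ, ih, h1, h2,
        Finset.prod_range_succ, Finset.prod_range_succ]
      ring
  have h2 := (tendsto_euler_sinh_div_prod (mul_ne_zero two_ne_zero hw)).comp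
    (tendsto_id.const_mul_atTop' (two_pos : 0 < 2))
  have h := h2.div (tendsto_euler_sinh_div_prod hw) (div_ne_zero hsinh hpw)
  convert! h using 1
  · ext K
    have hpos : ∏ k ∈ Finset.range K, (1 + w ^ 2 / ((k : ℝ) + 1) ^ 2) ≠ 0 :=
      Finset.prod_ne_zero_iff.2 fun k _ => by positivity
    simp only [Pi.div_apply, Function.comp_apply, id_eq]
    rw [hsplit, mul_div_cancel_right₀ _ hpos]
  · rw [show Real.pi * (2 * w) = 2 * (Real.pi * w) by ring, Real.sinh_two_mul]
    congr 1
    field_simp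

/-! ### The multiplier of the inequality -/

/-- The function `c r cosh (b r) / sinh (c r)`, extended continuously to `r = 0`. -/
noncomputable def coshDivSinhc (b c r : ℝ) : ℝ :=
  if r = 0 then 1 else c * r * Real.cosh (b * r) / Real.sinh (c * r)

/-- The `k`-th zero `k + 1/2` of the cosine is paired with the zero `k + 1` of the sine. Since
`(k + 1) / 2 ≤ k + 1/2`, the condition `2 |b| ≤ c` makes every quotient of Euler factors a
contractive multiplier. -/
theorem IsUnitarilyInvariantNorm.isContractiveMultiplier_coshDivSinhc {n : Type*} [Fintype n]
    [DecidableEq n] {N : Seminorm ℂ (Matrix n n ℂ)} (hN : IsUnitarilyInvariantNorm N)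
    (x y : n → ℝ) {b c : ℝ} (hc : 0 < c) (hbc : 2 * |b| ≤ c) :
    IsContractiveMultiplier N (Matrix.of fun i j => (coshDivSinhc b c (x i - y j) : ℂ)) := by
  have hπ := Real.pi_pos
  have hquot : ∀ k : ℕ, (b / (Real.pi * (k + 1 / 2))) ^ 2 ≤ (c / (Real.pi * (k + 1))) ^ 2 := by
    intro k
    rw [sq_le_sq, abs_div, abs_div, abs_of_pos hc,
      abs_of_pos (show 0 < Real.pi * ((k : ℝ) + 1 / 2) by positivity),
      abs_of_pos (show 0 < Real.pi * ((k : ℝ) + 1) by positivity),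
      div_le_div_iff₀ (by positivity) (by positivity)]
    have hk : |b| * (k + 1) ≤ c * (k + 1 / 2) := by
      nlinarith [mul_nonneg (Nat.cast_nonneg (α := ℝ) k) (abs_nonneg b),
        mul_le_mul_of_nonneg_left hbc (Nat.cast_nonneg (α := ℝ) k)]
    nlinarith [mul_le_mul_of_nonneg_left hk hπ.le]
  refine IsContractiveMultiplier.of_tendsto (Eventually.of_forall fun K =>
    hN.isContractiveMultiplier_prod_quotient x y
      (a := fun k : ℕ => c / (Real.pi * (k + 1))) (b := fun k : ℕ => b / (Real.pi * (k + 1 / 2)))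
      (fun k => by positivity) hquot K) (l := atTop) fun i j => ?_
  refine (Complex.continuous_ofReal.tendsto _).comp ?_
  generalize x i - y j = r
  rcases eq_or_ne r 0 with rfl | hr
  · simp [coshDivSinhc]
  rw [coshDivSinhc, if_neg hr]
  have hcr : c * r / Real.pi ≠ 0 := by positivity
  have hsinh : Real.sinh (c * r) ≠ 0 := by
    rw [ne_eq, Real.sinh_eq_zero]
    positivity
  have hπc : Real.pi * (c * r / Real.pi) = c * r := by field_simp
  have hπb : Real.pi * (b * r / Real.pi) = b * r := by field_simp
  have h := (tendsto_euler_cosh_prod (b * r / Real.pi)).div (tendsto_euler_sinh_div_prod hcr)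
    (by rw [hπc]; exact div_ne_zero hsinh (mul_ne_zero hc.ne' hr))
  convert! h using 1
  · ext K
    rw [Pi.div_apply, ← Finset.prod_div_distrib]
    refine Finset.prod_congr rfl fun k _ => ?_
    congr 2
    · field_simp
    · field_simp
  · rw [hπc, hπb]
    field_simp

/-! ### Integrals of powers -/

theorem intervalIntegrable_rpow_mul_rpow {a b s : ℝ} (ha : 0 ≤ a) (hb : 0 ≤ b) (hs₀ : 0 ≤ s)
    (hs : s < 1 / 2) :
    IntervalIntegrable (fun v => a ^ v * b ^ (1 - v)) MeasureTheory.volume s (1 - s) := by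
  rw [intervalIntegrable_iff_integrableOn_Ioo_of_le (by linarith)]
  rcases ha.eq_or_lt with rfl | ha
  · refine MeasureTheory.integrableOn_zero.congr_fun (fun v hv => ?_) measurableSet_Ioo
    simp [Real.zero_rpow (by linarith [hv.1] : v ≠ 0)]
  rcases hb.eq_or_lt with rfl | hb
  · refine MeasureTheory.integrableOn_zero.congr_fun (fun v hv => ?_) measurableSet_Ioo
    simp [Real.zero_rpow (by linarith [hv.2] : 1 - v ≠ 0)]
  have hcont : Continuous fun v : ℝ => a ^ v * b ^ (1 - v) := by
    have := ha.ne'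
    have := hb.ne'
    exact (Real.continuous_const_rpow ‹_›).mul
      ((Real.continuous_const_rpow ‹_›).comp (continuous_const.sub continuous_id))
  exact (hcont.integrableOn_Icc).mono_set Set.Ioo_subset_Icc_self

/-- The scalar identity behind the inequality. When `a = 0` or `b = 0` both sides vanish, so that
the junk value `log 0 = 0` is harmless. -/
theorem heinz_eq_coshDivSinhc_mul_integral {a b s t : ℝ} (ha : 0 ≤ a) (hb : 0 ≤ b) (hs₀ : 0 ≤ s)
    (hs : s < 1 / 2) (ht : |1 - 2 * t| < (1 - 2 * s) / 2) :
    a ^ (1 - t) * b ^ t + a ^ t * b ^ (1 - t) =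
      2 / (1 - 2 * s) * (coshDivSinhc ((1 - 2 * t) / 2) ((1 - 2 * s) / 2)
        (Real.log a - Real.log b) * ∫ v in s..(1 - s), a ^ v * b ^ (1 - v)) := by
  obtain ⟨ht1, ht2⟩ := abs_lt.1 ht
  have hγ : 1 - 2 * s ≠ 0 := by linarith
  have hle : s ≤ 1 - s := by linarith
  rcases ha.eq_or_lt with rfl | ha
  · have h0 : ∫ v in s..(1 - s), (0 : ℝ) ^ v * b ^ (1 - v) = 0 := by
      rw [intervalIntegral.integral_of_le hle]
      refine MeasureTheory.setIntegral_eq_zero_of_forall_eq_zero fun v hv => ?_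
      rw [Real.zero_rpow (by linarith [hv.1]), zero_mul]
    rw [h0, Real.zero_rpow (by linarith), Real.zero_rpow (by linarith)]
    simp
  rcases hb.eq_or_lt with rfl | hb
  · have h0 : ∫ v in s..(1 - s), a ^ v * (0 : ℝ) ^ (1 - v) = 0 := by
      rw [intervalIntegral.integral_of_le hle, MeasureTheory.integral_Ioc_eq_integral_Ioo]
      refine MeasureTheory.setIntegral_eq_zero_of_forall_eq_zero fun v hv => ?_
      rw [Real.zero_rpow (by linarith [hv.2]), mul_zero]
    rw [h0, Real.zero_rpow (by linarith), Real.zero_rpow (by linarith)]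
    simp
  obtain ⟨p, rfl⟩ : ∃ p, a = Real.exp p := ⟨Real.log a, (Real.exp_log ha).symm⟩
  obtain ⟨q, rfl⟩ : ∃ q, b = Real.exp q := ⟨Real.log b, (Real.exp_log hb).symm⟩
  simp only [← Real.exp_mul, ← Real.exp_add, Real.log_exp]
  rw [coshDivSinhc]
  split_ifs with hd
  · obtain rfl : p = q := sub_eq_zero.1 hd
    have : ∀ v : ℝ, p * v + p * (1 - v) = p := fun v => by ring
    simp only [this, intervalIntegral.integral_const, smul_eq_mul,
      show p * (1 - t) + p * t = p by ring]
    field_simp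
    ring
  have hI : ∫ v in s..(1 - s), Real.exp (p * v + q * (1 - v)) =
      Real.exp ((p + q) / 2) * (2 * Real.sinh ((1 - 2 * s) / 2 * (p - q)) / (p - q)) := by
    have hderiv : ∀ v ∈ Set.uIcc s (1 - s),
        HasDerivAt (fun v => Real.exp (p * v + q * (1 - v)) / (p - q))
          (Real.exp (p * v + q * (1 - v))) v := by
      intro v _
      have h1 : HasDerivAt (fun v : ℝ => p * v + q * (1 - v)) (p - q) v := by
        have h2 := ((hasDerivAt_id v).const_mul p).add (((hasDerivAt_id v).const_sub 1).const_mul q)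
        convert! h2 using 1
        ring
      have h3 := h1.exp.div_const (p - q)
      rwa [mul_div_cancel_right₀ _ hd] at h3
    rw [intervalIntegral.integral_eq_sub_of_hasDerivAt hderiv
      (Continuous.intervalIntegrable (by fun_prop) _ _), Real.sinh_eq, mul_div_cancel₀ _ two_ne_zero,
      ← mul_div_assoc, mul_sub (Real.exp _), ← Real.exp_add, ← Real.exp_add, ← sub_div]
    congr 3 <;> ring
  have hsinh : Real.sinh ((1 - 2 * s) / 2 * (p - q)) ≠ 0 := by
    rw [ne_eq, Real.sinh_eq_zero]
    exact mul_ne_zero (div_ne_zero hγ two_ne_zero) hd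
  have hcosh : Real.exp (p * (1 - t) + q * t) + Real.exp (p * t + q * (1 - t)) =
      Real.exp ((p + q) / 2) * (2 * Real.cosh ((1 - 2 * t) / 2 * (p - q))) := by
    rw [Real.cosh_eq, mul_div_cancel₀ _ two_ne_zero, mul_add, ← Real.exp_add, ← Real.exp_add]
    congr 2 <;> ring
  rw [hI, hcosh]
  field_simp

/-! ### Diagonalization -/

theorem Matrix.PosSemidef.rpow_eq_conj_diagonal {n : Type*} [Fintype n] [DecidableEq n]
    {A : Matrix n n ℂ} (hA : A.PosSemidef) (t : ℝ) :
    A ^ t = (hA.1.eigenvectorUnitary : Matrix n n ℂ) *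
      Matrix.diagonal (fun i => ((hA.1.eigenvalues i ^ t : ℝ) : ℂ)) *
        star (hA.1.eigenvectorUnitary : Matrix n n ℂ) := by
  rw [CFC.rpow_eq_cfc_real hA.nonneg, hA.1.cfc_eq, Matrix.IsHermitian.cfc,
    Unitary.conjStarAlgAut_apply]
  rfl

theorem matrixIntegral_mul_mul {n : Type*} [Fintype n] {F : ℝ → Matrix n n ℂ} {a b : ℝ}
    (hF : ∀ i j, IntervalIntegrable (fun v => F v i j) MeasureTheory.volume a b)
    (P Q : Matrix n n ℂ) :
    matrixIntegral (fun v => P * F v * Q) a b = P * matrixIntegral F a b * Q := by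
  ext i j
  simp only [matrixIntegral, Matrix.of_apply, Matrix.mul_apply]
  have hsum : ∀ k, IntervalIntegrable (fun v => ∑ l, P i l * F v l k) MeasureTheory.volume a b :=
    fun k => by
      simpa only [Finset.sum_fn] using
        IntervalIntegrable.sum Finset.univ fun l _ => (hF l k).const_mul (P i l)
  rw [intervalIntegral.integral_finsetSum fun k _ => (hsum k).mul_const _]
  refine Finset.sum_congr rfl fun k _ => ?_
  rw [intervalIntegral.integral_mul_const,
    intervalIntegral.integral_finsetSum fun l _ => (hF l k).const_mul _]
  simp only [intervalIntegral.integral_const_mul]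

/-- The real powers `A ^ t` of positive semidefinite matrices are those of the continuous
functional calculus. -/
theorem theorem2p3 {n : Type*} [Fintype n] [DecidableEq n]
    (N : Seminorm ℂ (Matrix n n ℂ)) (hN : IsUnitarilyInvariantNorm N)
    (A B : Matrix n n ℂ) (hA : A.PosSemidef) (hB : B.PosSemidef) (X : Matrix n n ℂ)
    (s t : ℝ) (hs₀ : 0 ≤ s) (hs : s < 1 / 2) (ht : |1 - 2 * t| < (1 - 2 * s) / 2) :
    N (A ^ (1 - t) * X * B ^ t + A ^ t * X * B ^ (1 - t)) ≤
      2 / (1 - 2 * s) * N (matrixIntegral (fun v => A ^ v * X * B ^ (1 - v)) s (1 - s)) := by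
  set U := (hA.1.eigenvectorUnitary : Matrix n n ℂ)
  set V := (hB.1.eigenvectorUnitary : Matrix n n ℂ)
  set a := hA.1.eigenvalues
  set b := hB.1.eigenvalues
  have ha : ∀ i, 0 ≤ a i := hA.eigenvalues_nonneg
  have hb : ∀ i, 0 ≤ b i := hB.eigenvalues_nonneg
  have hUmem : U ∈ Matrix.unitaryGroup n ℂ := hA.1.eigenvectorUnitary.2
  have hVmem : star V ∈ Matrix.unitaryGroup n ℂ := Unitary.star_mem hB.1.eigenvectorUnitary.2
  -- In the eigenbases, multiplication by powers is multiplication of entries by scalars.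
  set W : Matrix n n ℂ := star U * X * V with hW
  set G : ℝ → ℝ → Matrix n n ℂ := fun u v =>
    Matrix.of fun i j => ((a i ^ u * b j ^ v : ℝ) : ℂ) * W i j with hG
  have hpow : ∀ u v : ℝ, A ^ u * X * B ^ v = U * G u v * star V := by
    intro u v
    have hdiag : G u v = Matrix.diagonal (fun i => ((a i ^ u : ℝ) : ℂ)) * W *
        Matrix.diagonal (fun j => ((b j ^ v : ℝ) : ℂ)) := by
      ext i j
      simp only [hG, Matrix.mul_diagonal, Matrix.diagonal_mul, Matrix.of_apply, Complex.ofReal_mul]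
      ring
    rw [hA.rpow_eq_conj_diagonal, hB.rpow_eq_conj_diagonal, hdiag, hW]
    simp only [Matrix.mul_assoc]
    rfl
  have hint : ∀ i j, IntervalIntegrable (fun v => G v (1 - v) i j) MeasureTheory.volume
      s (1 - s) := fun i j =>
    IntervalIntegrable.mul_const ⟨(intervalIntegrable_rpow_mul_rpow (ha i) (hb j) hs₀ hs).1.ofReal,
      (intervalIntegrable_rpow_mul_rpow (ha i) (hb j) hs₀ hs).2.ofReal⟩ (W i j)
  simp only [hpow]
  rw [matrixIntegral_mul_mul hint, hN.unitary_mul_mul _ hUmem _ hVmem, ← Matrix.add_mul,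
    ← Matrix.mul_add, hN.unitary_mul_mul _ hUmem _ hVmem]
  have hmult := hN.isContractiveMultiplier_coshDivSinhc (fun i => Real.log (a i))
    (fun j => Real.log (b j)) (b := (1 - 2 * t) / 2) (c := (1 - 2 * s) / 2) (by linarith)
    (by rw [abs_div, abs_two]; linarith)
  have hschur : G (1 - t) t + G t (1 - t) = ((2 / (1 - 2 * s) : ℝ) : ℂ) •
      ((Matrix.of fun i j => (coshDivSinhc ((1 - 2 * t) / 2) ((1 - 2 * s) / 2)
        (Real.log (a i) - Real.log (b j)) : ℂ)) ⊙
          matrixIntegral (fun v => G v (1 - v)) s (1 - s)) := by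
    ext i j
    have hscalar := heinz_eq_coshDivSinhc_mul_integral (ha i) (hb j) hs₀ hs ht
    simp only [hG, matrixIntegral, Matrix.add_apply, Matrix.smul_apply, Matrix.hadamard_apply,
      Matrix.of_apply, smul_eq_mul]
    rw [intervalIntegral.integral_mul_const, intervalIntegral.integral_ofReal, ← add_mul,
      ← Complex.ofReal_add, hscalar]
    push_cast
    ring
  rw [hschur, map_smul_eq_mul, Complex.norm_of_nonneg (div_nonneg two_pos.le (by linarith))]
  exact mul_le_mul_of_nonneg_left (hmult _) (div_nonneg two_pos.le (by linarith))
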